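/- Let $R$ be an associative ring with identity; "module" means left $R$-module. For an integer $m\ge 0$, a module $M$ is called $m$-presented if there is an exact sequence of modules $F_m\to F_{m-1}\to\cdots\to F_0\to M\to 0$ in which every $F_i$ is finitely generated and free. Let $\mathscr X$ be a class of modules, let $n\ge 1$ be an integer, and let $\mathscr X_n$ be the subclass of the $n$-presented modules belonging to $\mathscr X$. The ring $R$ is called left $n$-$\mathscr X$-coherent if $\mathscr X_n$ is not empty and every module in $\mathscr X_n$ is $(n+1)$-presented. Theorem. Suppose that $\mathscr X_n$ is not empty. Then the following assertions are equivalent: 1. $R$ is left $n$-$\mathscr X$-coherent; 2. for every set $J$ and every $M\in\mathscr X_n$, the canonical homomorphism $R^J\otimes_R M\to M^J$, $(r_j)_{j}\otimes m\mapsto (r_jm)_{j}$, is bijective, and $\mathrm{Tor}^R_i(R^J,M)=0$ for every $0<i\le n$; 3. for every family $(P_j)_{j\in J}$ of right $R$-modules, the canonical homomorphism $$\mathrm{Tor}^R_i\Big(\prod_{j\in J}P_j,\,M\Big)\to\prod_{j\in J}\mathrm{Tor}^R_i(P_j,M)$$ induced by the projections is bijective for every $0\le i\le n$ and every $M\in\mathscr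 X_n$; 4. for every direct system $(N_j)_{j\in J}$ of modules over a (non-empty) directed index set $J$, the canonical homomorphism $$\varinjlim \mathrm{Ext}^i_R(M,N_j)\to\mathrm{Ext}^i_R\big(M,\varinjlim N_j\big)$$ is bijective for every $0\le i\le n$ and every $M\in\mathscr X_n$. -/

import Mathlib

open CategoryTheory CategoryTheory.Limits
open scoped TensorProduct

universe u

namespace RelCoherent

section Presented

variable (R : Type u) [Ring R]

/-- A left `R`-module `M` is `n`-presented if there is an exact sequence
`F_n → F_{n-1} → ⋯ → F_0 → M → 0` with every `F_i = R^(k i)` finitely generated free. Here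
`d i : F_{i+1} → F_i`; only the terms `F_i` with `i ≤ n` and the maps `d i` with `i < n` are
constrained. -/
def IsNPresented (n : ℕ) (M : Type u) [AddCommGroup M] [Module R M] : Prop :=
  ∃ (k : ℕ → ℕ) (d : ∀ i : ℕ, (Fin (k (i + 1)) → R) →ₗ[R] (Fin (k i) → R))
    (ε : (Fin (k 0) → R) →ₗ[R] M),
    Function.Surjective ε ∧
    (0 < n → Function.Exact (d 0) ε) ∧
    ∀ i : ℕ, i + 1 < n → Function.Exact (d (i + 1)) (d i)

/-- The subclass `X_n` of the `n`-presented modules belonging to the class `X`. -/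
def presentedSubclass (X : ModuleCat.{u} R → Prop) (n : ℕ) (M : ModuleCat.{u} R) : Prop :=
  X M ∧ IsNPresented R n M

/-- `R` is left `n`-`X`-coherent: `X_n` is not empty and each of its members is
`(n+1)`-presented. -/
def IsLeftCoherent (X : ModuleCat.{u} R → Prop) (n : ℕ) : Prop :=
  (∃ M : ModuleCat.{u} R, presentedSubclass R X n M) ∧
    ∀ M : ModuleCat.{u} R, presentedSubclass R X n M → IsNPresented R (n + 1) M

end Presented

section Tensor

/-! ### The tensor product `P ⊗_R M` over a possibly noncommutative ring

Right `R`-modules are modules over `Rᵐᵒᵖ`, with `p r = MulOpposite.op r • p`. -/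

variable (R : Type u) [Ring R]

/-- The subgroup of `P ⊗_ℤ M` generated by the elements `p r ⊗ m - p ⊗ r m`. -/
def balancedRelations (P M : Type u) [AddCommGroup P] [Module Rᵐᵒᵖ P]
    [AddCommGroup M] [Module R M] : AddSubgroup (P ⊗[ℤ] M) :=
  AddSubgroup.closure
    {x | ∃ (p : P) (r : R) (m : M), x = (MulOpposite.op r • p) ⊗ₜ[ℤ] m - p ⊗ₜ[ℤ] (r • m)}

/-- The abelian group `P ⊗_R M`, for a right module `P` and a left module `M`. -/
abbrev BalancedTensor (P M : Type u) [AddCommGroup P] [Module Rᵐᵒᵖ P]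
    [AddCommGroup M] [Module R M] : Type u :=
  (P ⊗[ℤ] M) ⧸ balancedRelations R P M

variable {R}

/-- The element `p ⊗ m` of `P ⊗_R M`. -/
def BalancedTensor.tmul {P M : Type u} [AddCommGroup P] [Module Rᵐᵒᵖ P]
    [AddCommGroup M] [Module R M] (p : P) (m : M) : BalancedTensor R P M :=
  QuotientAddGroup.mk (p ⊗ₜ[ℤ] m)

theorem BalancedTensor.hom_ext {P M A : Type u} [AddCommGroup P] [Module Rᵐᵒᵖ P]
    [AddCommGroup M] [Module R M] [AddCommGroup A] {f g : BalancedTensor R P M →+ A}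
    (h : ∀ (p : P) (m : M), f (BalancedTensor.tmul p m) = g (BalancedTensor.tmul p m)) :
    f = g := by
  ext x
  induction x using TensorProduct.induction_on with
  | zero => rw [map_zero, map_zero]
  | tmul p m => exact h p m
  | add x y hx hy => rw [map_add, map_add, hx, hy]

/-- A biadditive map `φ` with `φ (p r) m = φ p (r m)` induces a homomorphism on `P ⊗_R M`. -/
def BalancedTensor.lift {P M A : Type u} [AddCommGroup P] [Module Rᵐᵒᵖ P]
    [AddCommGroup M] [Module R M] [AddCommGroup A] (φ : P →+ M →+ A)
    (hφ : ∀ (p : P) (r : R) (m : M), φ (MulOpposite.op r • p) m = φ p (r • m)) :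
    BalancedTensor R P M →+ A :=
  QuotientAddGroup.lift (balancedRelations R P M)
    (TensorProduct.liftAddHom φ fun c p m => by
      rw [map_zsmul, map_zsmul, AddMonoidHom.zsmul_apply]) (by
      rw [balancedRelations, AddSubgroup.closure_le]
      rintro _ ⟨p, r, m, rfl⟩
      rw [SetLike.mem_coe, AddMonoidHom.mem_ker, map_sub, sub_eq_zero]
      exact hφ p r m)

theorem BalancedTensor.lift_tmul {P M A : Type u} [AddCommGroup P] [Module Rᵐᵒᵖ P]
    [AddCommGroup M] [Module R M] [AddCommGroup A] (φ : P →+ M →+ A)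
    (hφ : ∀ (p : P) (r : R) (m : M), φ (MulOpposite.op r • p) m = φ p (r • m))
    (p : P) (m : M) : BalancedTensor.lift φ hφ (BalancedTensor.tmul p m) = φ p m :=
  rfl

theorem BalancedTensor.smul_tmul {P M : Type u} [AddCommGroup P] [Module Rᵐᵒᵖ P]
    [AddCommGroup M] [Module R M] (p : P) (r : R) (m : M) :
    (BalancedTensor.tmul (MulOpposite.op r • p) m : BalancedTensor R P M) =
      BalancedTensor.tmul p (r • m) := by
  refine (QuotientAddGroup.eq_iff_sub_mem).2 ?_
  exact AddSubgroup.subset_closure ⟨p, r, m, rfl⟩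

/-- The map `f ⊗ g : P ⊗_R M → P' ⊗_R M'`. -/
def BalancedTensor.map {P P' M M' : Type u}
    [AddCommGroup P] [Module Rᵐᵒᵖ P] [AddCommGroup P'] [Module Rᵐᵒᵖ P']
    [AddCommGroup M] [Module R M] [AddCommGroup M'] [Module R M']
    (f : P →ₗ[Rᵐᵒᵖ] P') (g : M →ₗ[R] M') :
    BalancedTensor R P M →+ BalancedTensor R P' M' :=
  BalancedTensor.lift
    (AddMonoidHom.mk' (fun p => AddMonoidHom.mk' (fun m => BalancedTensor.tmul (f p) (g m))
        (fun m m' => by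
          rw [map_add]
          exact congrArg QuotientAddGroup.mk (TensorProduct.tmul_add (f p) (g m) (g m'))))
      (fun p p' => by
        ext m
        rw [AddMonoidHom.mk'_apply, map_add]
        exact congrArg QuotientAddGroup.mk (TensorProduct.add_tmul (f p) (f p') (g m))))
    (fun p r m => by
      simp only [AddMonoidHom.mk'_apply, map_smul]
      exact BalancedTensor.smul_tmul (f p) r (g m))

/-- The canonical map `R^J ⊗_R M → M^J`, `(r_j)_j ⊗ m ↦ (r_j m)_j`. -/
def powerTensorMap (J : Type u) (M : Type u) [AddCommGroup M] [Module R M] :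
    BalancedTensor R (J → R) M →+ (J → M) :=
  BalancedTensor.lift
    (AddMonoidHom.mk' (fun a => AddMonoidHom.mk' (fun m j => a j • m)
        (fun m m' => funext fun j => smul_add (a j) m m'))
      (fun a b => AddMonoidHom.ext fun m => funext fun j => add_smul (a j) (b j) m))
    (fun a r m => funext fun j => mul_smul (a j) r m)

variable (R) in
/-- The bifunctor `(P, M) ↦ P ⊗_R M`. -/
def tensorFunctor : ModuleCat.{u} Rᵐᵒᵖ ⥤ ModuleCat.{u} R ⥤ AddCommGrpCat.{u} where
  obj P :=
    { obj := fun M => AddCommGrpCat.of (BalancedTensor R P M)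
      map := fun g => AddCommGrpCat.ofHom (BalancedTensor.map LinearMap.id g.hom)
      map_id := fun _ => AddCommGrpCat.hom_ext (BalancedTensor.hom_ext fun _ _ => rfl)
      map_comp := fun _ _ => AddCommGrpCat.hom_ext (BalancedTensor.hom_ext fun _ _ => rfl) }
  map f :=
    { app := fun _ => AddCommGrpCat.ofHom (BalancedTensor.map f.hom LinearMap.id)
      naturality := fun _ _ _ =>
        AddCommGrpCat.hom_ext (BalancedTensor.hom_ext fun _ _ => rfl) }
  map_id P := by
    ext M : 2
    exact AddCommGrpCat.hom_ext (BalancedTensor.hom_ext fun _ _ => rfl)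
  map_comp f f' := by
    ext M : 2
    exact AddCommGrpCat.hom_ext (BalancedTensor.hom_ext fun _ _ => rfl)

instance (P : ModuleCat.{u} Rᵐᵒᵖ) : ((tensorFunctor R).obj P).Additive where
  map_add {M M' g g'} :=
    AddCommGrpCat.hom_ext (BalancedTensor.hom_ext fun p m =>
      congrArg (QuotientAddGroup.mk (s := balancedRelations R P M'))
        (TensorProduct.tmul_add p (g.hom m) (g'.hom m)))

variable (R) in
/-- `Tor_i^R(P, M)`, as a functor in both variables: the `i`-th left derived functor of
`P ⊗_R -` evaluated at `M`. -/
noncomputable def tor (i : ℕ) : ModuleCat.{u} Rᵐᵒᵖ ⥤ ModuleCat.{u} R ⥤ AddCommGrpCat.{u} where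
  obj P := ((tensorFunctor R).obj P).leftDerived i
  map f := NatTrans.leftDerived ((tensorFunctor R).map f) i
  map_id P := by
    rw [CategoryTheory.Functor.map_id]
    exact NatTrans.leftDerived_id _ i
  map_comp f g := by
    rw [CategoryTheory.Functor.map_comp]
    exact NatTrans.leftDerived_comp _ _ i

/-- The canonical map `Tor_i(∏ P_j, M) → ∏ Tor_i(P_j, M)`, whose `j`-th component is induced by
the projection `∏ P_j → P_j`. -/
noncomputable def torPiComparison (i : ℕ) {J : Type u} (P : J → ModuleCat.{u} Rᵐᵒᵖ)
    (M : ModuleCat.{u} R) :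
    ((tor R i).obj (ModuleCat.of Rᵐᵒᵖ (∀ j, P j))).obj M →+
      (∀ j, ((tor R i).obj (P j)).obj M) :=
  AddMonoidHom.pi fun j =>
    (((tor R i).map (Y := P j)
      (ModuleCat.ofHom (LinearMap.proj j : (∀ j, P j) →ₗ[Rᵐᵒᵖ] P j))).app M).hom

end Tensor

section ExtLimit

variable {R : Type u} [Ring R]

/-- The canonical map `colim Ext^i(M, N_j) → Ext^i(M, colim N_j)` induced by the maps
`N_j → colim N_j`. -/
noncomputable def extColimitComparison (i : ℕ) {J : Type u} [Preorder J]
    (N : J ⥤ ModuleCat.{u} R) (M : ModuleCat.{u} R) :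
    colimit (N ⋙ Abelian.extFunctorObj.{u} M i) ⟶
      (Abelian.extFunctorObj.{u} M i).obj (colimit N) :=
  colimit.post N (Abelian.extFunctorObj.{u} M i)

end ExtLimit

end RelCoherent

/-! Let `M` be `n`-presented, `n ≥ 1`, and take a projective resolution of `M` with finite free
terms in degrees `≤ n`. Let `K` be the kernel of its differential from degree `n` to degree `n - 1`.
If `K` is finitely generated, then `M` is `(n+1)`-presented (`isNPresented_succ_of_resolution`).

From coherence: once the terms are finite free up to degree `n + 1`, tensoring with them commutes
with products and mapping out of them commutes with directed colimits. Hence so do Tor and Ext in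
degrees `≤ n`. Taking every `P_j` equal to `R` turns the statement on products into the vanishing of
`Tor_i(R^J, M)`.

Back to coherence, only degree `n` matters. For Tor, take `J = K`: the inclusion of `K` is a cycle
in `R^K ⊗ F_n`, hence a boundary, and the finitely many right factors of a tensor bounding it map to
generators of `K` (`ker_fg_of_exact_tensor`). For Ext, take the quotients `F_n / L` with `L ≤ K`
finitely generated: the map from `F_n` to their colimit is a cocycle, and lifting its class to one
stage forces `K = L` for some `L` (`ker_fg_of_extColimitComparison_surjective`). -/

namespace RelCoherent

/-! ### Finite free presentations and projective resolutions. -/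

section Resolution

variable {R : Type u} [Ring R]

theorem IsNPresented.exists_syzygy {m : ℕ} {M : Type u} [AddCommGroup M] [Module R M]
    (h : IsNPresented R (m + 1) M) :
    ∃ (k : ℕ) (ε : (Fin k → R) →ₗ[R] M), Function.Surjective ε ∧
      IsNPresented R m (LinearMap.ker ε) := by
  obtain ⟨k, d, ε, hε, h0, h1⟩ := h
  have hd : ∀ x, d 0 x ∈ LinearMap.ker ε := fun x => (h0 m.succ_pos _).2 ⟨x, rfl⟩
  refine ⟨k 0, ε, hε, fun i => k (i + 1), fun i => d (i + 1), (d 0).codRestrict _ hd, ?_, ?_,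
    fun i hi => h1 (i + 1) (by omega)⟩
  · rintro ⟨x, hx⟩
    obtain ⟨y, rfl⟩ := (h0 m.succ_pos _).1 hx
    exact ⟨y, rfl⟩
  · intro hm x
    rw [← h1 0 (by omega) x, Subtype.ext_iff]
    rfl

theorem IsNPresented.exists_surjective {m : ℕ} {M : Type u} [AddCommGroup M] [Module R M]
    (h : IsNPresented R m M) :
    ∃ (k : ℕ) (ε : (Fin k → R) →ₗ[R] M), Function.Surjective ε := by
  obtain ⟨k, d, ε, hε, -⟩ := h
  exact ⟨k 0, ε, hε⟩

theorem IsNPresented.mono {m m' : ℕ} (hm : m ≤ m') {M : Type u} [AddCommGroup M] [Module R M]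
    (h : IsNPresented R m' M) : IsNPresented R m M := by
  obtain ⟨k, d, ε, hε, h0, h1⟩ := h
  exact ⟨k, d, ε, hε, fun h => h0 (by omega), fun i hi => h1 i (by omega)⟩

variable (R) in
/-- A module that is `(len - 1)`-presented if `len` is positive. -/
structure PresentedModule where
  carrier : ModuleCat.{u} R
  len : ℕ
  presented : 0 < len → IsNPresented R (len - 1) carrier

/-- One step of a resolution. `len` counts the terms that can still be chosen finite free; each step
uses one up, and at `0` the cover is free on all elements of the module. -/
theorem PresentedModule.exists_cover (s : PresentedModule.{u} R) :
    ∃ (t : PresentedModule.{u} R) (F : ModuleCat.{u} R) (ι : t.carrier →ₗ[R] F)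
      (π : F →ₗ[R] s.carrier), Module.Projective R F ∧ Function.Injective ι ∧
        Function.Surjective π ∧ Function.Exact ι π ∧ t.len = s.len - 1 ∧
        (0 < s.len → Module.Free R F ∧ Module.Finite R F) := by
  obtain ⟨K, m, h⟩ := s
  rcases m with _ | _ | m
  · refine ⟨⟨ModuleCat.of R (LinearMap.ker (Finsupp.linearCombination R (id : K → K))), 0,
      fun h => absurd h (lt_irrefl 0)⟩, ModuleCat.of R (K →₀ R), Submodule.subtype _,
      Finsupp.linearCombination R (id : K → K), inferInstanceAs (Module.Projective R (K →₀ R)),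
      Subtype.val_injective, Finsupp.linearCombination_id_surjective R K,
      LinearMap.exact_subtype_ker_map _, rfl, fun h => absurd h (lt_irrefl 0)⟩
  · obtain ⟨k, ε, hε⟩ := (h Nat.one_pos).exists_surjective
    refine ⟨⟨ModuleCat.of R (LinearMap.ker ε), 0, fun h => absurd h (lt_irrefl 0)⟩,
      ModuleCat.of R (Fin k → R), Submodule.subtype _, ε,
      inferInstanceAs (Module.Projective R (Fin k → R)), Subtype.val_injective, hε,
      LinearMap.exact_subtype_ker_map _, rfl, fun _ =>
        ⟨inferInstanceAs (Module.Free R (Fin k → R)),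
          inferInstanceAs (Module.Finite R (Fin k → R))⟩⟩
  · obtain ⟨k, ε, hε, hK⟩ := (h (Nat.succ_pos _)).exists_syzygy
    refine ⟨⟨ModuleCat.of R (LinearMap.ker ε), m + 1, fun _ => hK⟩,
      ModuleCat.of R (Fin k → R), Submodule.subtype _, ε,
      inferInstanceAs (Module.Projective R (Fin k → R)), Subtype.val_injective, hε,
      LinearMap.exact_subtype_ker_map _, rfl, fun _ =>
        ⟨inferInstanceAs (Module.Free R (Fin k → R)),
          inferInstanceAs (Module.Finite R (Fin k → R))⟩⟩

/-- The projective resolution given by an exact sequence of modules. -/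
theorem exists_projectiveResolution_of_exact (M : ModuleCat.{u} R) (X : ℕ → ModuleCat.{u} R)
    [∀ i, Module.Projective R (X i)] (d : ∀ i, X (i + 1) ⟶ X i) (ε : X 0 ⟶ M)
    (hε : Function.Surjective ε) (h0 : Function.Exact (d 0) ε)
    (h1 : ∀ i, Function.Exact (d (i + 1)) (d i)) :
    ∃ P : ProjectiveResolution M, ∀ i, P.complex.X i = X i := by
  have hdd : ∀ i, d (i + 1) ≫ d i = 0 := fun i => by
    ext x
    exact (h1 i _).2 ⟨x, rfl⟩
  have hdε : d 0 ≫ ε = 0 := by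
    ext x
    exact (h0 _).2 ⟨x, rfl⟩
  have hprev : ∀ i, Projective (X i) := fun i =>
    (IsProjective.iff_projective (X i)).1 inferInstance
  have hd : ∀ i, (ChainComplex.of X d hdd).d (i + 1) i = d i := ChainComplex.of_d X d
  obtain ⟨φ, hφ⟩ : ∃ φ : ChainComplex.of X d hdd ⟶ (ChainComplex.single₀ _).obj M, φ.f 0 = ε :=
    ⟨(ChainComplex.toSingle₀Equiv _ _).symm ⟨ε, by rw [hd 0]; exact hdε⟩,
      ChainComplex.toSingle₀Equiv_symm_apply_f_zero _ _⟩
  refine ⟨{ complex := ChainComplex.of X d hdd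
            projective := fun i => hprev i
            π := φ
            quasiIso := ⟨fun i => ?_⟩ }, fun i => rfl⟩
  rcases i with _ | i
  · rw [ChainComplex.quasiIsoAt₀_iff, ShortComplex.quasiIso_iff_of_zeros']
    · refine (ShortComplex.exact_and_epi_g_iff_of_iso (S₂ := ShortComplex.mk (d 0) ε hdε) ?_).2
        ⟨(ShortComplex.ShortExact.moduleCat_exact_iff_function_exact _).2 h0,
          (ModuleCat.epi_iff_surjective _).2 hε⟩
      exact ShortComplex.isoMk (Iso.refl _) (Iso.refl _) (Iso.refl _)
          ((Category.id_comp _).trans ((hd 0).symm.trans (Category.comp_id _).symm))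
          ((Category.id_comp _).trans (hφ.symm.trans (Category.comp_id _).symm))
    all_goals rfl
  · rw [quasiIsoAt_iff_exactAt']
    · rw [HomologicalComplex.exactAt_iff' _ (i + 1 + 1) (i + 1) i (by simp) (by simp)]
      refine (ShortComplex.ShortExact.moduleCat_exact_iff_function_exact _).2 ?_
      change Function.Exact ((ChainComplex.of X d hdd).d (i + 2) (i + 1))
        ((ChainComplex.of X d hdd).d (i + 1) i)
      rw [hd, hd]
      exact h1 i
    · apply ChainComplex.exactAt_succ_single_obj

theorem IsNPresented.exists_projectiveResolution {m : ℕ} {M : ModuleCat.{u} R}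
    (h : IsNPresented R m M) :
    ∃ P : ProjectiveResolution M, ∀ i ≤ m,
      Module.Free R (P.complex.X i) ∧ Module.Finite R (P.complex.X i) := by
  choose next F ι π hF hι hπ hex hlen hfree using PresentedModule.exists_cover (R := R)
  -- Iterated syzygies. Starting from `m + 1` makes exactly the degrees `0, …, m` finite free.
  let S : ℕ → PresentedModule.{u} R := fun i => Nat.rec ⟨M, m + 1, fun _ => h⟩ (fun _ s => next s) i
  have hS : ∀ i, (S i).len = m + 1 - i := by
    intro i
    induction i with
    | zero => rfl
    | succ i ih => exact (hlen (S i)).trans (by rw [ih]; omega)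
  have := fun i => hF (S i)
  let d : ∀ i, F (S (i + 1)) ⟶ F (S i) := fun i =>
    ModuleCat.ofHom ((ι (S i)).comp (π (S (i + 1))))
  have h0 : Function.Exact (d 0) (ModuleCat.ofHom (π (S 0))) := by
    intro x
    refine (hex (S 0) x).trans ⟨?_, ?_⟩
    · rintro ⟨y, rfl⟩
      obtain ⟨z, rfl⟩ := hπ (S 1) y
      exact ⟨z, rfl⟩
    · rintro ⟨z, rfl⟩
      exact ⟨π (S 1) z, rfl⟩
  have h1 : ∀ i, Function.Exact (d (i + 1)) (d i) := by
    intro i x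
    have : ι (S i) (π (S (i + 1)) x) = 0 ↔ π (S (i + 1)) x = 0 := by
      rw [← map_zero (ι (S i))]
      exact (hι (S i)).eq_iff
    refine this.trans ((hex (S (i + 1)) x).trans ⟨?_, ?_⟩)
    · rintro ⟨y, rfl⟩
      obtain ⟨z, rfl⟩ := hπ (S (i + 2)) y
      exact ⟨z, rfl⟩
    · rintro ⟨z, rfl⟩
      exact ⟨π (S (i + 2)) z, rfl⟩
  obtain ⟨P, hP⟩ := exists_projectiveResolution_of_exact M (fun i => F (S i)) d
    (ModuleCat.ofHom (π (S 0))) (hπ (S 0)) h0 h1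
  refine ⟨P, fun i hi => ?_⟩
  rw [hP i]
  exact hfree (S i) (by rw [hS]; omega)

end Resolution

/-! ### Reading a presentation off a resolution. -/

section Converse

variable {R : Type u} [Ring R] {M : ModuleCat.{u} R} (P : ProjectiveResolution M)

theorem resolution_surjective : Function.Surjective (P.π.f 0) :=
  (ModuleCat.epi_iff_surjective _).1 inferInstance

theorem resolution_exact_zero : Function.Exact (P.complex.d 1 0) (P.π.f 0) :=
  (ShortComplex.ShortExact.moduleCat_exact_iff_function_exact _).1 P.exact₀

theorem resolution_exact_succ (i : ℕ) :
    Function.Exact (P.complex.d (i + 2) (i + 1)) (P.complex.d (i + 1) i) :=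
  (ShortComplex.ShortExact.moduleCat_exact_iff_function_exact _).1 (P.exact_succ i)

/-- Bases identify the terms in degrees `≤ m + 1` with powers of `R`. The term in degree `m + 2` may
be infinite, so it is replaced by a finite free module with the same image under the differential;
higher degrees are unconstrained and set to zero. -/
theorem isNPresented_succ_of_resolution {m : ℕ}
    (hP : ∀ i ≤ m + 1, Module.Free R (P.complex.X i) ∧ Module.Finite R (P.complex.X i))
    (hK : (LinearMap.ker (P.complex.d (m + 1) m).hom).FG) : IsNPresented R (m + 2) M := by
  have he : ∀ i, ∃ (k : ℕ) (e : (Fin k → R) →ₗ[R] P.complex.X i),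
      (i ≤ m + 1 → Function.Bijective e) ∧
      (i = m + 2 → LinearMap.range ((P.complex.d i (i - 1)).hom.comp e) =
        LinearMap.range (P.complex.d i (i - 1)).hom) := by
    intro i
    by_cases hi : i ≤ m + 1
    · obtain ⟨_, _⟩ := hP i hi
      let b := Module.Free.chooseBasis R (P.complex.X i)
      let e := (Fintype.equivFin (Module.Free.ChooseBasisIndex R (P.complex.X i)))
      exact ⟨_, (b.reindex e).equivFun.symm.toLinearMap, fun _ => LinearEquiv.bijective _,
        by omega⟩
    by_cases hi' : i = m + 2
    · subst hi'
      have hr : LinearMap.range (P.complex.d (m + 2) (m + 1)).hom =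
          LinearMap.ker (P.complex.d (m + 1) m).hom :=
        (LinearMap.exact_iff.1 (resolution_exact_succ P m)).symm
      rw [← hr] at hK
      have : Module.Finite R (LinearMap.range (P.complex.d (m + 2) (m + 1)).hom) :=
        Module.Finite.iff_fg.2 hK
      obtain ⟨k, f, hf⟩ := Module.Finite.exists_fin' R
        (LinearMap.range (P.complex.d (m + 2) (m + 1)).hom)
      -- The finite cover of the image lifts to the resolution because `R^k` is projective.
      obtain ⟨g, hg⟩ := Module.projective_lifting_property
        (P.complex.d (m + 2) (m + 1)).hom.rangeRestrict f (LinearMap.surjective_rangeRestrict _)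
      refine ⟨k, g, by omega, fun _ => le_antisymm (LinearMap.range_comp_le_range _ _) ?_⟩
      rintro _ ⟨x, rfl⟩
      obtain ⟨y, hy⟩ := hf ⟨_, x, rfl⟩
      refine ⟨y, ?_⟩
      have := congrArg Subtype.val (hy ▸ LinearMap.congr_fun hg y)
      exact this
    · exact ⟨0, 0, by omega, by omega⟩
  choose k e he he' using he
  have hd : ∀ i, ∃ d : (Fin (k (i + 1)) → R) →ₗ[R] (Fin (k i) → R),
      i ≤ m + 1 → ∀ x, e i (d x) = P.complex.d (i + 1) i (e (i + 1) x) := by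
    intro i
    by_cases hi : i ≤ m + 1
    · refine ⟨(LinearEquiv.ofBijective (e i) (he i hi)).symm.toLinearMap.comp
        ((P.complex.d (i + 1) i).hom.comp (e (i + 1))), fun _ x => ?_⟩
      exact (LinearEquiv.ofBijective (e i) (he i hi)).apply_symm_apply _
    · exact ⟨0, fun h => absurd h hi⟩
  choose d hd using hd
  -- `e (m + 2)` need not be onto; exactness only needs it to reach the whole image of the
  -- differential.
  have hrange : ∀ i ≤ m + 1, ∀ y, (∃ x, P.complex.d (i + 1) i x = y) →
      ∃ x, P.complex.d (i + 1) i (e (i + 1) x) = y := by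
    rintro i hi y ⟨x, rfl⟩
    rcases Nat.lt_or_ge i (m + 1) with hi' | hi'
    · obtain ⟨x, rfl⟩ := (he (i + 1) (by omega)).2 x
      exact ⟨x, rfl⟩
    · have := he' (i + 1) (by omega)
      have hx : P.complex.d (i + 1) i x ∈ LinearMap.range (P.complex.d (i + 1) i).hom := ⟨x, rfl⟩
      exact (this.symm.le hx)
  refine ⟨k, d, (P.π.f 0).hom.comp (e 0), ?_, fun _ x => ?_, fun i hi x => ?_⟩
  · exact (resolution_surjective P).comp (he 0 (by omega)).2
  · refine (resolution_exact_zero P (e 0 x)).trans ⟨fun h => ?_, ?_⟩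
    · obtain ⟨y, hy⟩ := hrange 0 (by omega) _ h
      exact ⟨y, (he 0 (by omega)).1 (by rw [hd 0 (by omega), hy])⟩
    · rintro ⟨y, rfl⟩
      exact ⟨e 1 y, (hd 0 (by omega) y).symm⟩
  · have : d i x = 0 ↔ P.complex.d (i + 1) i (e (i + 1) x) = 0 := by
      rw [← hd i (by omega), ← map_zero (e i), (he i (by omega)).1.eq_iff]
    refine this.trans ((resolution_exact_succ P i (e (i + 1) x)).trans ⟨fun h => ?_, ?_⟩)
    · obtain ⟨y, hy⟩ := hrange (i + 1) (by omega) _ h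
      exact ⟨y, (he (i + 1) (by omega)).1 (by rw [hd (i + 1) (by omega), hy])⟩
    · rintro ⟨y, rfl⟩
      exact ⟨e (i + 2) y, (hd (i + 1) (by omega) y).symm⟩

end Converse

/-! ### Maps from finite modules to directed colimits. -/

section FilteredColimit

variable {R : Type u} [Ring R] {J : Type u} [Preorder J] [IsDirectedOrder J] [Nonempty J]
  (N : J ⥤ ModuleCat.{u} R)

theorem exists_ge_of_finite {ι : Type*} [Finite ι] (j : J) (f : ι → J) :
    ∃ k, j ≤ k ∧ ∀ i, f i ≤ k := by
  obtain ⟨k, hk⟩ := Finite.exists_le f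
  obtain ⟨l, hl, hl'⟩ := exists_ge_ge j k
  exact ⟨l, hl, fun i => (hk i).trans hl'⟩

theorem colimit_ι_map_apply {J : Type u} [Preorder J] (N : J ⥤ ModuleCat.{u} R) {j k : J} (h : j ⟶ k) (x : N.obj j) :
    colimit.ι N k (N.map h x) = colimit.ι N j x :=
  ConcreteCategory.congr_hom (colimit.w N h) x

/-- A map from a finite free module to a directed colimit factors through some stage. -/
theorem exists_factor_colimit {F : ModuleCat.{u} R} [Module.Free R F] [Module.Finite R F]
    (g : F ⟶ colimit N) : ∃ (j : J) (g' : F ⟶ N.obj j), g' ≫ colimit.ι N j = g := by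
  let b := Module.Free.chooseBasis R F
  choose f y hy using fun i => Concrete.colimit_exists_rep N (g (b i))
  obtain ⟨k, -, hk⟩ := exists_ge_of_finite (Classical.arbitrary J) f
  -- `ℕ` serves as the commuting scalars of `constr`, since `R` may be noncommutative.
  refine ⟨k, ModuleCat.ofHom (b.constr ℕ fun i => N.map (homOfLE (hk i)) (y i)), ?_⟩
  refine ModuleCat.hom_ext (b.ext fun i => ?_)
  change colimit.ι N k (b.constr ℕ (fun i => N.map (homOfLE (hk i)) (y i)) (b i)) = g (b i)
  rw [b.constr_basis, colimit_ι_map_apply, hy]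

/-- Two maps from a finitely generated module which agree in a directed colimit agree at some
stage. -/
theorem exists_eq_of_colimit_eq {F : ModuleCat.{u} R} [Module.Finite R F] {j : J}
    (f g : F ⟶ N.obj j) (h : f ≫ colimit.ι N j = g ≫ colimit.ι N j) :
    ∃ (k : J) (u : j ⟶ k), f ≫ N.map u = g ≫ N.map u := by
  obtain ⟨s, hs⟩ := Module.finite_def.1 (inferInstance : Module.Finite R F)
  have : ∀ x : s, ∃ (k : J) (u : j ⟶ k), N.map u (f x) = N.map u (g x) := fun x =>
    ((colimit.isColimit N).eq_iff' (f x) (g x)).1 (ConcreteCategory.congr_hom h (x : F))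
  choose t u hu using this
  obtain ⟨k, hk, hk'⟩ := exists_ge_of_finite j t
  refine ⟨k, homOfLE hk, ModuleCat.hom_ext (LinearMap.ext_on hs fun x hx => ?_)⟩
  have e : homOfLE hk = u ⟨x, hx⟩ ≫ homOfLE (hk' ⟨x, hx⟩) := rfl
  change N.map (homOfLE hk) (f x) = N.map (homOfLE hk) (g x)
  rw [e, N.map_comp]
  exact congrArg (N.map (homOfLE (hk' ⟨x, hx⟩))) (hu ⟨x, hx⟩)

theorem colimit_ι_eq_zero {J : Type u} [Preorder J] (N : J ⥤ AddCommGrpCat.{u}) {j k : J}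
    (u : j ⟶ k) (x : N.obj j) (h : N.map u x = 0) : colimit.ι N j x = 0 := by
  have h1 : colimit.ι N k (N.map u x) = colimit.ι N j x :=
    ConcreteCategory.congr_hom (colimit.w N u) x
  rw [← h1, h, map_zero]

end FilteredColimit

/-! ### Ext and directed colimits. -/

section Ext

variable {R : Type u} [Ring R] {J : Type u} [Preorder J]
  (N : J ⥤ ModuleCat.{u} R) {M : ModuleCat.{u} R}

theorem extColimitComparison_ι (i : ℕ) (j : J) (x : Abelian.Ext.{u} M (N.obj j) i) :
    extColimitComparison i N M (colimit.ι (N ⋙ Abelian.extFunctorObj.{u} M i) j x) =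
      x.comp (Abelian.Ext.mk₀ (colimit.ι N j)) (add_zero i) :=
  ConcreteCategory.congr_hom (colimit.ι_post N (Abelian.extFunctorObj.{u} M i) j) x

theorem ext_ι_eq_zero (i : ℕ) {j k : J} (u : j ⟶ k) (x : Abelian.Ext.{u} M (N.obj j) i)
    (h : x.comp (Abelian.Ext.mk₀ (N.map u)) (add_zero i) = 0) :
    colimit.ι (N ⋙ Abelian.extFunctorObj.{u} M i) j x = 0 := by
  exact colimit_ι_eq_zero (N ⋙ Abelian.extFunctorObj.{u} M i) u x h

variable [IsDirectedOrder J] [Nonempty J]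

theorem exists_ext_rep (i : ℕ) (x : ToType (colimit (N ⋙ Abelian.extFunctorObj.{u} M i))) :
    ∃ (j : J) (y : Abelian.Ext.{u} M (N.obj j) i),
      colimit.ι (N ⋙ Abelian.extFunctorObj.{u} M i) j y = x :=
  Concrete.colimit_exists_rep _ x

theorem extColimitComparison_zero_injective [Module.Finite R M] :
    Function.Injective (extColimitComparison 0 N M) := by
  rw [injective_iff_map_eq_zero]
  intro x hx
  obtain ⟨j, y, rfl⟩ := exists_ext_rep N 0 x
  replace hx : y.comp (Abelian.Ext.mk₀ (colimit.ι N j)) (add_zero 0) = 0 :=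
    (extColimitComparison_ι N 0 j y).symm.trans hx
  obtain ⟨f, rfl⟩ := (Abelian.Ext.mk₀_bijective M (N.obj j)).2 y
  rw [Abelian.Ext.mk₀_comp_mk₀, Abelian.Ext.mk₀_eq_zero_iff] at hx
  obtain ⟨k, u, hu⟩ := exists_eq_of_colimit_eq N f 0 (by rw [hx, zero_comp])
  refine ext_ι_eq_zero N 0 u _ ?_
  rw [Abelian.Ext.mk₀_comp_mk₀, hu, zero_comp, Abelian.Ext.mk₀_zero]

variable (P : ProjectiveResolution M)

/-- If a cocycle becomes a coboundary in the colimit, the bounding map on the finite free term `i`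
descends to a stage, and the coboundary equation, an equality of maps on the finitely generated term
`i + 1`, holds at a later stage. -/
theorem extColimitComparison_succ_injective (i : ℕ)
    [Module.Free R (P.complex.X i)] [Module.Finite R (P.complex.X i)]
    [Module.Finite R (P.complex.X (i + 1))] :
    Function.Injective (extColimitComparison (i + 1) N M) := by
  rw [injective_iff_map_eq_zero]
  intro x hx
  obtain ⟨j, y, rfl⟩ := exists_ext_rep N (i + 1) x
  replace hx : y.comp (Abelian.Ext.mk₀ (colimit.ι N j)) (add_zero (i + 1)) = 0 :=
    (extColimitComparison_ι N (i + 1) j y).symm.trans hx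
  obtain ⟨f, hf, rfl⟩ := P.extMk_surjective y (i + 2) rfl
  rw [P.extMk_comp_mk₀, P.extMk_eq_zero_iff _ _ _ _ i rfl] at hx
  obtain ⟨g, hg⟩ := hx
  obtain ⟨j', g', rfl⟩ := exists_factor_colimit N g
  obtain ⟨k, hk, hk'⟩ := exists_ge_ge j j'
  obtain ⟨l, v, hv⟩ := exists_eq_of_colimit_eq N (f ≫ N.map (homOfLE hk))
    (P.complex.d (i + 1) i ≫ g' ≫ N.map (homOfLE hk'))
    (by simp only [Category.assoc, colimit.w]; exact hg.symm)
  refine ext_ι_eq_zero N (i + 1) (homOfLE hk ≫ v) _ ?_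
  rw [P.extMk_comp_mk₀, P.extMk_eq_zero_iff _ _ _ _ i rfl]
  exact ⟨g' ≫ N.map (homOfLE hk' ≫ v), by simpa using hv.symm⟩

/-- A cocycle on the finite free term `i` descends to a stage; its cocycle condition lives on the
finitely generated term `i + 1`, so it holds further along. -/
theorem extColimitComparison_surjective (i : ℕ)
    [Module.Free R (P.complex.X i)] [Module.Finite R (P.complex.X i)]
    [Module.Finite R (P.complex.X (i + 1))] :
    Function.Surjective (extColimitComparison i N M) := by
  intro x
  obtain ⟨f, hf, rfl⟩ := P.extMk_surjective (Y := colimit N) x (i + 1) rfl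
  obtain ⟨j, f', rfl⟩ := exists_factor_colimit N f
  obtain ⟨k, u, hu⟩ := exists_eq_of_colimit_eq N (P.complex.d (i + 1) i ≫ f') 0
    (by rw [Category.assoc, hf, zero_comp])
  refine ⟨colimit.ι (N ⋙ Abelian.extFunctorObj.{u} M i) k
    (P.extMk (f' ≫ N.map u) (i + 1) rfl (by rw [← Category.assoc, hu, zero_comp])), ?_⟩
  refine (extColimitComparison_ι N i k _).trans ?_
  rw [P.extMk_comp_mk₀]
  congr 1
  rw [Category.assoc, colimit.w]

theorem IsNPresented.extColimitComparison_bijective {n : ℕ} (h : IsNPresented R (n + 1) M)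
    {i : ℕ} (hi : i ≤ n) : Function.Bijective (extColimitComparison i N M) := by
  obtain ⟨P, hP⟩ := h.exists_projectiveResolution
  obtain ⟨_, _⟩ := hP i (by omega)
  obtain ⟨_, _⟩ := hP (i + 1) (by omega)
  refine ⟨?_, extColimitComparison_surjective N P i⟩
  rcases i with _ | i
  · have : Module.Finite R M := Module.Finite.of_surjective _ (resolution_surjective P)
    exact extColimitComparison_zero_injective N
  · obtain ⟨_, _⟩ := hP i (by omega)
    exact extColimitComparison_succ_injective N P i

end Ext

/-! ### The directed system of quotients by finitely generated submodules. -/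

section Quotients

variable {R : Type u} [Ring R] {F : ModuleCat.{u} R} (K : Submodule R F)

/-- The finitely generated submodules of `K`. -/
abbrev FGSubmodule : Type u := {L : Submodule R F // L.FG ∧ L ≤ K}

instance : Nonempty (FGSubmodule K) := ⟨⟨⊥, Submodule.fg_bot, bot_le⟩⟩

instance : IsDirectedOrder (FGSubmodule K) :=
  ⟨fun L L' => ⟨⟨L.1 ⊔ L'.1, L.2.1.sup L'.2.1, sup_le L.2.2 L'.2.2⟩,
    (le_sup_left : L.1 ≤ L.1 ⊔ L'.1), (le_sup_right : L'.1 ≤ L.1 ⊔ L'.1)⟩⟩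

/-- The direct system of the quotients of `F` by the finitely generated submodules of `K`. -/
def quotientSystem : FGSubmodule K ⥤ ModuleCat.{u} R where
  obj L := ModuleCat.of R (F ⧸ L.1)
  map {L L'} h := ModuleCat.ofHom (Submodule.factor (leOfHom h : L.1 ≤ L'.1))
  map_id _ := ModuleCat.hom_ext (Submodule.linearMap_qext _ rfl)
  map_comp _ _ := ModuleCat.hom_ext (Submodule.linearMap_qext _ rfl)

/-- The projection `F → F / L`. -/
def quotientSystemProj (L : FGSubmodule K) : F ⟶ (quotientSystem K).obj L :=
  ModuleCat.ofHom L.1.mkQ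

theorem quotientSystemProj_map {L L' : FGSubmodule K} (h : L ⟶ L') :
    quotientSystemProj K L ≫ (quotientSystem K).map h = quotientSystemProj K L' :=
  rfl

theorem quotientSystemProj_ι (L L' : FGSubmodule K) :
    quotientSystemProj K L ≫ colimit.ι (quotientSystem K) L =
      quotientSystemProj K L' ≫ colimit.ι (quotientSystem K) L' := by
  obtain ⟨k, hk, hk'⟩ := exists_ge_ge L L'
  rw [← colimit.w _ (homOfLE hk), ← colimit.w _ (homOfLE hk'), ← Category.assoc,
    ← Category.assoc, quotientSystemProj_map, quotientSystemProj_map]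

/-- The map from `F` to the colimit is the same through every stage, and `x` already dies at the
stage `F / Rx`. -/
theorem quotientSystemProj_ι_apply (L : FGSubmodule K) {x : F} (hx : x ∈ K) :
    colimit.ι (quotientSystem K) L (quotientSystemProj K L x) = 0 := by
  let L' : FGSubmodule K :=
    ⟨R ∙ x, Submodule.fg_span_singleton x, (Submodule.span_singleton_le_iff_mem x K).2 hx⟩
  have h := ConcreteCategory.congr_hom (quotientSystemProj_ι K L L') x
  refine h.trans ?_
  have h0 : quotientSystemProj K L' x = 0 :=
    (Submodule.Quotient.mk_eq_zero _).2 (Submodule.mem_span_singleton_self x)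
  change colimit.ι (quotientSystem K) L' (quotientSystemProj K L' x) = 0
  rw [h0, map_zero]

end Quotients

/-! ### Finite generation of a syzygy from Ext. -/

section ExtConverse

variable {R : Type u} [Ring R] {M : ModuleCat.{u} R} (P : ProjectiveResolution M)

theorem ker_fg_of_extColimitComparison_surjective (i : ℕ)
    [Module.Free R (P.complex.X i)] [Module.Finite R (P.complex.X i)]
    [Module.Finite R (P.complex.X (i + 1))]
    (h : Function.Surjective (extColimitComparison (i + 1)
      (quotientSystem (LinearMap.ker (P.complex.d (i + 1) i).hom)) M)) :
    (LinearMap.ker (P.complex.d (i + 1) i).hom).FG := by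
  set K := LinearMap.ker (P.complex.d (i + 1) i).hom with hK
  let N := quotientSystem K
  have hdK : ∀ y, P.complex.d (i + 2) (i + 1) y ∈ K := fun y =>
    (resolution_exact_succ P i _).2 ⟨y, rfl⟩
  let L₀ : FGSubmodule K := Classical.arbitrary _
  have hq : P.complex.d (i + 2) (i + 1) ≫ quotientSystemProj K L₀ ≫ colimit.ι N L₀ = 0 := by
    ext y
    exact quotientSystemProj_ι_apply K L₀ (hdK y)
  obtain ⟨x, hx⟩ := h (P.extMk (quotientSystemProj K L₀ ≫ colimit.ι N L₀) (i + 2) rfl hq)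
  obtain ⟨L, y, rfl⟩ := exists_ext_rep N (i + 1) x
  replace hx : y.comp (Abelian.Ext.mk₀ (colimit.ι N L)) (add_zero (i + 1)) =
      P.extMk (quotientSystemProj K L₀ ≫ colimit.ι N L₀) (i + 2) rfl hq :=
    (extColimitComparison_ι N (i + 1) L y).symm.trans hx
  obtain ⟨c, hc, rfl⟩ := P.extMk_surjective y (i + 2) rfl
  rw [P.extMk_comp_mk₀, ← sub_eq_zero, P.sub_extMk, P.extMk_eq_zero_iff _ _ _ _ i rfl] at hx
  obtain ⟨g, hg⟩ := hx
  obtain ⟨L₁, g, rfl⟩ := exists_factor_colimit N g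
  obtain ⟨L₂, h₂, h₂'⟩ := exists_ge_ge L L₁
  -- A cocycle minus a coboundary represents the projection in the colimit, hence equals it at some
  -- stage `L₃`.
  obtain ⟨L₃, v, hv⟩ := exists_eq_of_colimit_eq N
    (c ≫ N.map (homOfLE h₂) - P.complex.d (i + 1) i ≫ g ≫ N.map (homOfLE h₂'))
    (quotientSystemProj K L₂) (by
      simp only [Category.assoc, colimit.w, Preadditive.sub_comp]
      rw [quotientSystemProj_ι K L₂ L₀, hg]
      abel)
  -- Both the cocycle and the coboundary vanish on boundaries, which fill `K`; so the projection to
  -- `F / L₃` kills `K`.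
  have hKL : K ≤ L₃.1 := by
    intro x hx
    obtain ⟨y, rfl⟩ := (resolution_exact_succ P i x).1 hx
    have h0 : P.complex.d (i + 2) (i + 1) ≫ quotientSystemProj K L₃ = 0 := by
      rw [← quotientSystemProj_map K v]
      erw [← hv]
      simp [reassoc_of% hc]
    exact (Submodule.Quotient.mk_eq_zero _).1 (ConcreteCategory.congr_hom h0 y)
  rw [le_antisymm hKL L₃.2.2]
  exact L₃.2.1

end ExtConverse

/-! ### Tensor products with finite free modules and with powers of `R`. -/

section BalancedTensor

variable {R : Type u} [Ring R] {P M : Type u} [AddCommGroup P] [Module Rᵐᵒᵖ P]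
  [AddCommGroup M] [Module R M]

namespace BalancedTensor

theorem tmul_add (p : P) (m m' : M) :
    (tmul p (m + m') : BalancedTensor R P M) = tmul p m + tmul p m' :=
  congrArg QuotientAddGroup.mk (TensorProduct.tmul_add p m m')

theorem add_tmul (p p' : P) (m : M) :
    (tmul (p + p') m : BalancedTensor R P M) = tmul p m + tmul p' m :=
  congrArg QuotientAddGroup.mk (TensorProduct.add_tmul p p' m)

theorem map_tmul {P' M' : Type u} [AddCommGroup P'] [Module Rᵐᵒᵖ P'] [AddCommGroup M']
    [Module R M'] (f : P →ₗ[Rᵐᵒᵖ] P') (g : M →ₗ[R] M') (p : P) (m : M) :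
    map f g (tmul p m) = tmul (f p) (g m) :=
  rfl

theorem tmul_zero (p : P) : (tmul p (0 : M) : BalancedTensor R P M) = 0 :=
  congrArg QuotientAddGroup.mk (TensorProduct.tmul_zero M p)

theorem zero_tmul (m : M) : (tmul (0 : P) m : BalancedTensor R P M) = 0 :=
  congrArg QuotientAddGroup.mk (TensorProduct.zero_tmul P m)

theorem tmul_sum {ι : Type*} (s : Finset ι) (p : P) (m : ι → M) :
    (tmul p (∑ i ∈ s, m i) : BalancedTensor R P M) = ∑ i ∈ s, tmul p (m i) :=
  map_sum (AddMonoidHom.mk' (fun m => (tmul p m : BalancedTensor R P M)) (tmul_add p)) m s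

theorem induction_on {motive : BalancedTensor R P M → Prop} (x : BalancedTensor R P M)
    (zero : motive 0) (tmul : ∀ p m, motive (tmul p m))
    (add : ∀ x y, motive x → motive y → motive (x + y)) : motive x := by
  obtain ⟨x, rfl⟩ := QuotientAddGroup.mk_surjective x
  induction x using TensorProduct.induction_on with
  | zero => exact zero
  | tmul p m => exact tmul p m
  | add x y hx hy => exact add _ _ hx hy

/-- The coordinate maps `P ⊗_R M → P` of a basis of `M`. -/
noncomputable def coord {ι : Type*} (b : Module.Basis ι R M) (i : ι) : BalancedTensor R P M →+ P :=
  lift (AddMonoidHom.mk' (fun p => AddMonoidHom.mk' (fun m => MulOpposite.op (b.coord i m) • p)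
      fun m m' => by rw [map_add, MulOpposite.op_add, add_smul])
    fun p p' => AddMonoidHom.ext fun m => smul_add _ p p')
    fun p r m => by
      simp only [AddMonoidHom.mk'_apply, map_smul, smul_eq_mul, MulOpposite.op_mul, mul_smul]

theorem coord_tmul {ι : Type*} (b : Module.Basis ι R M) (i : ι) (p : P) (m : M) :
    coord b i (tmul p m) = MulOpposite.op (b.coord i m) • p :=
  rfl

theorem sum_coord_tmul {ι : Type*} [Fintype ι] (b : Module.Basis ι R M)
    (x : BalancedTensor R P M) : ∑ i, tmul (coord b i x) (b i) = x := by
  induction x using induction_on with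
  | zero => simp [zero_tmul]
  | tmul p m =>
    simp_rw [coord_tmul, smul_tmul, ← tmul_sum]
    exact congrArg (tmul p) (b.sum_repr m)
  | add x y hx hy => simp_rw [map_add, add_tmul, Finset.sum_add_distrib, hx, hy]

theorem coord_sum_tmul {ι : Type*} [Fintype ι] [DecidableEq ι] (b : Module.Basis ι R M)
    (p : ι → P) (j : ι) : coord b j (∑ i, (tmul (p i) (b i) : BalancedTensor R P M)) = p j := by
  simp [coord_tmul, Finsupp.single_apply, apply_ite MulOpposite.op, ite_smul]

theorem ext_coord {ι : Type*} [Fintype ι] (b : Module.Basis ι R M) {x y : BalancedTensor R P M}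
    (h : ∀ i, coord b i x = coord b i y) : x = y := by
  rw [← sum_coord_tmul b x, ← sum_coord_tmul b y]
  exact Finset.sum_congr rfl fun i _ => by rw [h i]

theorem coord_map {P' : Type u} [AddCommGroup P'] [Module Rᵐᵒᵖ P'] {ι : Type*}
    (b : Module.Basis ι R M) (f : P →ₗ[Rᵐᵒᵖ] P') (i : ι) (x : BalancedTensor R P M) :
    coord b i (map f LinearMap.id x) = f (coord b i x) := by
  induction x using induction_on with
  | zero => simp
  | tmul p m => simp only [map_tmul, coord_tmul, map_smul, LinearMap.id_apply]
  | add x y hx hy => simp only [map_add, hx, hy]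

theorem map_surjective {M' : Type u} [AddCommGroup M'] [Module R M'] (g : M →ₗ[R] M')
    (hg : Function.Surjective g) :
    Function.Surjective (map (LinearMap.id : P →ₗ[Rᵐᵒᵖ] P) g) := by
  intro x
  induction x using induction_on with
  | zero => exact ⟨0, map_zero _⟩
  | tmul p m =>
    obtain ⟨m, rfl⟩ := hg m
    exact ⟨tmul p m, rfl⟩
  | add x y hx hy =>
    obtain ⟨x, rfl⟩ := hx
    obtain ⟨y, rfl⟩ := hy
    exact ⟨x + y, map_add _ _ _⟩

theorem map_map {P' P'' M' M'' : Type u} [AddCommGroup P'] [Module Rᵐᵒᵖ P'] [AddCommGroup P'']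
    [Module Rᵐᵒᵖ P''] [AddCommGroup M'] [Module R M'] [AddCommGroup M''] [Module R M'']
    (f' : P' →ₗ[Rᵐᵒᵖ] P'') (f : P →ₗ[Rᵐᵒᵖ] P') (g' : M' →ₗ[R] M'') (g : M →ₗ[R] M')
    (x : BalancedTensor R P M) :
    map f' g' (map f g x) = map (f'.comp f) (g'.comp g) x :=
  DFunLike.congr_fun (hom_ext (f := (map f' g').comp (map f g))
    (g := map (f'.comp f) (g'.comp g)) fun _ _ => rfl) x

/-- For `F` finite free, `(∏ P_j) ⊗_R F → ∏ (P_j ⊗_R F)` is bijective. -/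
theorem pi_map_bijective {J : Type u} (Q : J → Type u) [∀ j, AddCommGroup (Q j)]
    [∀ j, Module Rᵐᵒᵖ (Q j)] [Module.Free R M] [Module.Finite R M] :
    Function.Bijective fun (x : BalancedTensor R (∀ j, Q j) M) (j : J) =>
      map (LinearMap.proj j : (∀ j, Q j) →ₗ[Rᵐᵒᵖ] Q j) (LinearMap.id : M →ₗ[R] M) x := by
  classical
  let b := Module.Free.chooseBasis R M
  refine ⟨fun x y h => ext_coord b fun i => funext fun j => ?_, fun y => ?_⟩
  · have := congrArg (coord b i) (congrFun h j)
    simp only [coord_map] at this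
    exact this
  · refine ⟨∑ i, tmul (fun j => coord b i (y j)) (b i), funext fun j => ext_coord b fun i => ?_⟩
    simp only [coord_map, coord_sum_tmul]
    rfl

/-- The canonical isomorphism `R ⊗_R M → M`, `r ⊗ m ↦ r m`. -/
def unitLeft (R M : Type u) [Ring R] [AddCommGroup M] [Module R M] : BalancedTensor R R M →+ M :=
  lift (AddMonoidHom.mk' (fun r => AddMonoidHom.mk' (fun m => r • m) (smul_add r))
    fun r r' => AddMonoidHom.ext fun m => add_smul r r' m) fun r r' m => mul_smul r r' m

theorem tmul_one_unitLeft (x : BalancedTensor R R M) : tmul (1 : R) (unitLeft R M x) = x := by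
  induction x using induction_on with
  | zero => rw [map_zero, tmul_zero]
  | tmul r m =>
    change tmul (1 : R) (r • m) = _
    rw [← smul_tmul, op_smul_eq_mul, one_mul]
  | add x y hx hy => rw [map_add, tmul_add, hx, hy]

theorem unitLeft_map {M' : Type u} [AddCommGroup M'] [Module R M'] (g : M →ₗ[R] M')
    (x : BalancedTensor R R M) :
    unitLeft R M' (map (LinearMap.id : R →ₗ[Rᵐᵒᵖ] R) g x) = g (unitLeft R M x) := by
  induction x using induction_on with
  | zero => simp only [map_zero]
  | tmul r m => exact (map_smul g r m).symm
  | add x y hx hy => simp only [map_add, hx, hy]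

end BalancedTensor

open BalancedTensor

theorem powerTensorMap_tmul (J : Type u) (a : J → R) (m : M) :
    powerTensorMap J M (tmul a m) = fun j => a j • m :=
  rfl

theorem powerTensorMap_map (J : Type u) {M' : Type u} [AddCommGroup M'] [Module R M']
    (g : M →ₗ[R] M') (x : BalancedTensor R (J → R) M) (j : J) :
    powerTensorMap J M' (map LinearMap.id g x) j = g (powerTensorMap J M x j) := by
  induction x using BalancedTensor.induction_on with
  | zero => simp only [map_zero, Pi.zero_apply]
  | tmul a m => exact (map_smul g (a j) m).symm
  | add x y hx hy => simp only [map_add, hx, hy, Pi.add_apply]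

/-- Coefficients of the entries on a fixed finite generating family assemble into finitely many
elements of `R^J`. -/
theorem powerTensorMap_surjective (J : Type u) [Module.Finite R M] :
    Function.Surjective (powerTensorMap (R := R) J M) := by
  intro y
  obtain ⟨k, f, hf⟩ := Module.Finite.exists_fin' R M
  choose c hc using fun j => hf (y j)
  refine ⟨∑ i, tmul (fun j => c j i) (f (Pi.single i 1)), funext fun j => ?_⟩
  rw [map_sum, Finset.sum_apply]
  simp only [powerTensorMap_tmul]
  rw [← hc j]
  conv_rhs => rw [pi_eq_sum_univ' (c j)]
  rw [map_sum]
  refine Finset.sum_congr rfl fun i _ => ?_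
  rw [← map_smul]

theorem coord_powerTensorMap (J : Type u) {ι : Type*} (b : Module.Basis ι R M)
    (x : BalancedTensor R (J → R) M) (i : ι) (j : J) :
    b.coord i (powerTensorMap J M x j) = BalancedTensor.coord b i x j := by
  induction x using BalancedTensor.induction_on with
  | zero => simp only [map_zero, Pi.zero_apply]
  | tmul a m => exact map_smul (b.coord i) (a j) m
  | add x y hx hy => simp only [map_add, hx, hy, Pi.add_apply]

theorem powerTensorMap_injective_of_free (J : Type u) [Module.Free R M] [Module.Finite R M] :
    Function.Injective (powerTensorMap (R := R) J M) := by
  let b := Module.Free.chooseBasis R M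
  refine fun x y h => ext_coord b fun i => funext fun j => ?_
  rw [← coord_powerTensorMap, ← coord_powerTensorMap, h]

/-- `R^J ⊗_R M → M^J` is bijective if `M` has a finite free presentation. -/
theorem powerTensorMap_bijective_of_presentation (J : Type u) {F₀ F₁ : Type u} [AddCommGroup F₀]
    [Module R F₀] [AddCommGroup F₁] [Module R F₁] [Module.Free R F₀] [Module.Finite R F₀]
    [Module.Finite R F₁] (d : F₁ →ₗ[R] F₀) (ε : F₀ →ₗ[R] M) (hε : Function.Surjective ε)
    (hd : Function.Exact d ε) : Function.Bijective (powerTensorMap (R := R) J M) := by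
  have : Module.Finite R M := Module.Finite.of_surjective ε hε
  refine ⟨(injective_iff_map_eq_zero _).2 fun x hx => ?_, powerTensorMap_surjective J⟩
  obtain ⟨x, rfl⟩ := map_surjective ε hε x
  -- The entries of the lift lie in `ker ε = range d`. Choosing preimages entrywise and realising
  -- them as a tensor over `F₁` exhibits the lift in the image of `1 ⊗ d`, which `ε` kills.
  have h : ∀ j, ∃ y, d y = powerTensorMap J F₀ x j := fun j =>
    (hd _).1 ((powerTensorMap_map J ε x j).symm.trans (congrFun hx j))
  choose y hy using h
  obtain ⟨z, hz⟩ := powerTensorMap_surjective (R := R) J y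
  have hxz : map LinearMap.id d z = x := powerTensorMap_injective_of_free J <| by
    ext j
    rw [powerTensorMap_map, hz, hy]
  rw [← hxz, map_map]
  have : ε.comp d = 0 := LinearMap.ext fun y => (hd _).2 ⟨y, rfl⟩
  rw [this]
  clear hxz hz
  induction z using BalancedTensor.induction_on with
  | zero => exact map_zero _
  | tmul a m => exact tmul_zero _
  | add x y hx hy => rw [map_add, hx, hy, add_zero]

/-- A tensor is a finite sum, so its right factors give one finite set serving all `j` at once. -/
theorem powerTensorMap_mem_span (J : Type u) (x : BalancedTensor R (J → R) M) :
    ∃ s : Finset M, ∀ j, powerTensorMap J M x j ∈ Submodule.span R (s : Set M) := by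
  classical
  induction x using BalancedTensor.induction_on with
  | zero => exact ⟨∅, fun j => by rw [map_zero]; exact zero_mem _⟩
  | tmul a m => exact ⟨{m}, fun j => Submodule.smul_mem _ _ (Submodule.subset_span (by simp))⟩
  | add x y hx hy =>
    obtain ⟨s, hs⟩ := hx
    obtain ⟨t, ht⟩ := hy
    refine ⟨s ∪ t, fun j => ?_⟩
    rw [map_add]
    exact add_mem (Submodule.span_mono (by simp) (hs j)) (Submodule.span_mono (by simp) (ht j))

/-- If `R^K ⊗_R -` preserves the exactness of `F₂ → F₁ → F₀`, where `K` is the kernel of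
`F₁ → F₀`, then `K` is finitely generated. -/
theorem ker_fg_of_exact_tensor {F₀ F₁ F₂ : Type u} [AddCommGroup F₀] [Module R F₀]
    [AddCommGroup F₁] [Module R F₁] [AddCommGroup F₂] [Module R F₂] [Module.Free R F₀]
    [Module.Finite R F₀] [Module.Free R F₁] [Module.Finite R F₁] (d₁ : F₂ →ₗ[R] F₁)
    (d₀ : F₁ →ₗ[R] F₀) (hd : ∀ x, d₀ (d₁ x) = 0)
    (h : ∀ x : BalancedTensor R (LinearMap.ker d₀ → R) F₁, map LinearMap.id d₀ x = 0 →
      ∃ y, map LinearMap.id d₁ y = x) : (LinearMap.ker d₀).FG := by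
  classical
  -- The tensor whose entry at `k` is `k` itself; once it is a boundary, finitely many elements
  -- generate every `k`.
  obtain ⟨x, hx⟩ := powerTensorMap_surjective (R := R) (LinearMap.ker d₀)
    (Subtype.val : LinearMap.ker d₀ → F₁)
  obtain ⟨y, rfl⟩ := h x (powerTensorMap_injective_of_free _ (by
    ext k
    rw [powerTensorMap_map, hx, map_zero]
    exact k.2))
  obtain ⟨s, hs⟩ := powerTensorMap_mem_span _ y
  refine ⟨s.image d₁, le_antisymm (Submodule.span_le.2 ?_) fun k hk => ?_⟩
  · intro z hz
    obtain ⟨z, -, rfl⟩ := Finset.mem_image.1 hz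
    exact hd z
  · have := congrFun hx ⟨k, hk⟩
    rw [powerTensorMap_map] at this
    rw [Finset.coe_image, Submodule.span_image, ← show _ = k from this]
    exact Submodule.mem_map_of_mem (hs _)

end BalancedTensor

/-! ### Homology of abelian groups and products. -/

section Homology

theorem ab_homologyπ_surjective (S : ShortComplex AddCommGrpCat.{u}) :
    Function.Surjective S.homologyπ :=
  (AddCommGrpCat.epi_iff_surjective _).1 inferInstance

theorem ab_exists_cycle (S : ShortComplex AddCommGrpCat.{u}) (x : S.X₂) (hx : S.g x = 0) :
    ∃ c : S.cycles, S.iCycles c = x :=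
  ⟨S.abCyclesIso.inv ⟨x, hx⟩, S.abCyclesIso_inv_apply_iCycles ⟨x, hx⟩⟩

theorem ab_iCycles_injective (S : ShortComplex AddCommGrpCat.{u}) :
    Function.Injective S.iCycles :=
  (AddCommGrpCat.mono_iff_injective _).1 inferInstance

theorem ab_homologyπ_eq_zero_iff (S : ShortComplex AddCommGrpCat.{u}) (c : S.cycles) :
    S.homologyπ c = 0 ↔ ∃ y : S.X₁, S.f y = S.iCycles c := by
  have hex : (ShortComplex.mk S.toCycles S.homologyπ S.toCycles_comp_homologyπ).Exact :=
    ShortComplex.exact_of_g_is_cokernel _ S.homologyIsCokernel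
  refine ((ShortComplex.ab_exact_iff_function_exact _).1 hex c).trans ⟨?_, ?_⟩
  · rintro ⟨y, rfl⟩
    exact ⟨y, (ConcreteCategory.congr_hom S.toCycles_i y).symm⟩
  · rintro ⟨y, hy⟩
    exact ⟨y, ab_iCycles_injective S ((ConcreteCategory.congr_hom S.toCycles_i y).trans hy)⟩

/-- Homology of short complexes of abelian groups commutes with products. -/
theorem ab_homologyMap_pi_bijective {J : Type*} {T : ShortComplex AddCommGrpCat.{u}}
    {S : J → ShortComplex AddCommGrpCat.{u}} (φ : ∀ j, T ⟶ S j)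
    (h₁ : Function.Surjective fun (x : T.X₁) j => (φ j).τ₁ x)
    (h₂ : Function.Bijective fun (x : T.X₂) j => (φ j).τ₂ x)
    (h₃ : Function.Injective fun (x : T.X₃) j => (φ j).τ₃ x) :
    Function.Bijective fun (x : T.homology) j => ShortComplex.homologyMap (φ j) x := by
  have hπ : ∀ j (c : T.cycles), ShortComplex.homologyMap (φ j) (T.homologyπ c) =
      (S j).homologyπ (ShortComplex.cyclesMap (φ j) c) := fun j c =>
    ConcreteCategory.congr_hom (ShortComplex.homologyπ_naturality (φ j)) c
  have hi : ∀ j (c : T.cycles), (S j).iCycles (ShortComplex.cyclesMap (φ j) c) =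
      (φ j).τ₂ (T.iCycles c) := fun j c =>
    ConcreteCategory.congr_hom (ShortComplex.cyclesMap_i (φ j)) c
  have hf : ∀ j (y : T.X₁), (φ j).τ₂ (T.f y) = (S j).f ((φ j).τ₁ y) := fun j y =>
    (ConcreteCategory.congr_hom (φ j).comm₁₂ y).symm
  have hg : ∀ j (y : T.X₂), (φ j).τ₃ (T.g y) = (S j).g ((φ j).τ₂ y) := fun j y =>
    (ConcreteCategory.congr_hom (φ j).comm₂₃ y).symm
  -- Injectivity assembles componentwise bounding elements by `h₁`; surjectivity assembles
  -- componentwise cycles by `h₂`, and `h₃` makes the result a cycle.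
  constructor
  · intro x y hxy
    rw [← sub_eq_zero]
    have hz : ∀ j, ShortComplex.homologyMap (φ j) (x - y) = 0 := fun j => by
      rw [map_sub, sub_eq_zero]
      exact congrFun hxy j
    obtain ⟨c, hc⟩ := ab_homologyπ_surjective T (x - y)
    rw [← hc] at hz ⊢
    have : ∀ j, ∃ w, (S j).f w = (φ j).τ₂ (T.iCycles c) := fun j => by
      rw [← hi]
      exact (ab_homologyπ_eq_zero_iff _ _).1 ((hπ j c).symm.trans (hz j))
    choose w hw using this
    obtain ⟨v, hv⟩ := h₁ w
    refine (ab_homologyπ_eq_zero_iff _ _).2 ⟨v, h₂.1 (funext fun j => ?_)⟩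
    change (φ j).τ₂ (T.f v) = (φ j).τ₂ (T.iCycles c)
    rw [hf, ← hw, ← hv]
  · intro y
    choose c hc using fun j => ab_homologyπ_surjective (S j) (y j)
    obtain ⟨x, hx⟩ := h₂.2 fun j => (S j).iCycles (c j)
    replace hx : ∀ j, (φ j).τ₂ x = (S j).iCycles (c j) := fun j => congrFun hx j
    have hx0 : T.g x = 0 := h₃ <| funext fun j => by
      change (φ j).τ₃ (T.g x) = (φ j).τ₃ 0
      rw [hg, hx, map_zero]
      exact ConcreteCategory.congr_hom (S j).iCycles_g (c j)
    obtain ⟨z, rfl⟩ := ab_exists_cycle T x hx0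
    refine ⟨T.homologyπ z, funext fun j => (hπ j z).trans ?_⟩
    rw [← hc]
    exact congrArg _ (ab_iCycles_injective _ ((hi j z).trans (hx j)))

end Homology

/-! ### Tor, products and powers of `R`. -/

section Tor

open BalancedTensor

variable {R : Type u} [Ring R] {M : ModuleCat.{u} R} (Q : ProjectiveResolution M)

/-- `Tor_{i+1}(P, M)` vanishes if and only if `P ⊗_R -` keeps a projective resolution of `M`
exact in degree `i + 1`. -/
theorem subsingleton_tor_succ_iff (P : ModuleCat.{u} Rᵐᵒᵖ) (i : ℕ) :
    Subsingleton (((tor R (i + 1)).obj P).obj M) ↔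
      ∀ x : BalancedTensor R P (Q.complex.X (i + 1)),
        map LinearMap.id (Q.complex.d (i + 1) i).hom x = 0 →
          ∃ y, map LinearMap.id (Q.complex.d (i + 2) (i + 1)).hom y = x := by
  let F := (tensorFunctor R).obj P
  let C := (F.mapHomologicalComplex (ComplexShape.down ℕ)).obj Q.complex
  have e : ((tor R (i + 1)).obj P).obj M ≅ C.homology (i + 1) :=
    Q.isoLeftDerivedObj F (i + 1)
  rw [← AddCommGrpCat.isZero_iff_subsingleton, e.isZero_iff,
    ← HomologicalComplex.exactAt_iff_isZero_homology,
    C.exactAt_iff' (i + 2) (i + 1) i (by simp) (by simp), ShortComplex.ab_exact_iff]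
  rfl

/-- `R ⊗_R -` is the identity up to natural isomorphism, so it keeps a resolution exact. -/
theorem subsingleton_tor_succ_self (i : ℕ) :
    Subsingleton (((tor R (i + 1)).obj (ModuleCat.of Rᵐᵒᵖ R)).obj M) := by
  let Q := ProjectiveResolution.of M
  refine (subsingleton_tor_succ_iff Q _ i).2 fun x hx => ?_
  have h : Q.complex.d (i + 1) i (unitLeft R _ x) = 0 := by
    have := unitLeft_map (Q.complex.d (i + 1) i).hom x
    exact this.symm.trans ((congrArg _ hx).trans (map_zero _))
  obtain ⟨y, hy⟩ := (resolution_exact_succ Q i _).1 h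
  refine ⟨tmul (1 : R) y, ?_⟩
  rw [map_tmul, ← tmul_one_unitLeft x]
  exact congrArg (tmul (1 : R)) hy

theorem torPiComparison_bijective_of_resolution {i : ℕ}
    (hQ : ∀ k ≤ i + 1, Module.Free R (Q.complex.X k) ∧ Module.Finite R (Q.complex.X k))
    {J : Type u} (P : J → ModuleCat.{u} Rᵐᵒᵖ) : Function.Bijective (torPiComparison i P M) := by
  let T := tensorFunctor R
  let p : ∀ j, ModuleCat.of Rᵐᵒᵖ (∀ j, P j) ⟶ P j := fun j => ModuleCat.ofHom (LinearMap.proj j)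
  let C : ModuleCat.{u} Rᵐᵒᵖ → ChainComplex AddCommGrpCat.{u} ℕ := fun N =>
    ((T.obj N).mapHomologicalComplex (ComplexShape.down ℕ)).obj Q.complex
  let φ : ∀ j, C (ModuleCat.of Rᵐᵒᵖ (∀ j, P j)) ⟶ C (P j) := fun j =>
    (NatTrans.mapHomologicalComplex (T.map (p j)) (ComplexShape.down ℕ)).app Q.complex
  have hφ : ∀ k ≤ i + 1, Function.Bijective
      fun (x : (C (ModuleCat.of Rᵐᵒᵖ (∀ j, P j))).X k) j => (φ j).f k x := by
    intro k hk
    obtain ⟨_, _⟩ := hQ k hk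
    exact pi_map_bijective (M := Q.complex.X k) fun j => P j
  have hH : Function.Bijective fun (x : (C (ModuleCat.of Rᵐᵒᵖ (∀ j, P j))).homology i) j =>
      HomologicalComplex.homologyMap (φ j) i x := by
    refine ab_homologyMap_pi_bijective
      (fun j => (HomologicalComplex.shortComplexFunctor _ (ComplexShape.down ℕ) i).map (φ j))
      (hφ _ (by simp)).2 (hφ i (by simp)) (hφ _ ?_).1
    -- The index after `0` in the complex shape is `0` itself, hence the case split.
    rcases i with _ | i <;> simp <;> omega
  have h : (torPiComparison i P M : _ → _) =
      (fun y j => (Q.isoLeftDerivedObj (T.obj (P j)) i).inv (y j)) ∘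
        (fun x j => HomologicalComplex.homologyMap (φ j) i x) ∘
          (Q.isoLeftDerivedObj (T.obj (ModuleCat.of Rᵐᵒᵖ (∀ j, P j))) i).hom := by
    funext x j
    exact ConcreteCategory.congr_hom (Q.leftDerived_app_eq (T.map (p j)) i) x
  rw [h]
  refine Function.Bijective.comp ?_ (hH.comp (ConcreteCategory.bijective_of_isIso _))
  exact Function.Bijective.piMap fun j => ConcreteCategory.bijective_of_isIso _

theorem IsNPresented.torPiComparison_bijective {n : ℕ} (h : IsNPresented R (n + 1) M) {i : ℕ}
    (hi : i ≤ n) {J : Type u} (P : J → ModuleCat.{u} Rᵐᵒᵖ) :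
    Function.Bijective (torPiComparison i P M) := by
  obtain ⟨Q, hQ⟩ := h.exists_projectiveResolution
  exact torPiComparison_bijective_of_resolution Q (fun k hk => hQ k (by omega)) P

theorem IsNPresented.powerTensorMap_bijective (h : IsNPresented R 1 M) (J : Type u) :
    Function.Bijective (powerTensorMap (R := R) J M) := by
  obtain ⟨Q, hQ⟩ := h.exists_projectiveResolution
  obtain ⟨_, _⟩ := hQ 0 (by omega)
  obtain ⟨_, _⟩ := hQ 1 le_rfl
  exact powerTensorMap_bijective_of_presentation J (Q.complex.d 1 0).hom (Q.π.f 0).hom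
    (resolution_surjective Q) (resolution_exact_zero Q)

/-- The target of the comparison is a product of groups `Tor_{i+1}(R, M) = 0`. -/
theorem subsingleton_tor_power {i : ℕ} {J : Type u}
    (h : Function.Bijective (torPiComparison (i + 1) (fun _ : J => ModuleCat.of Rᵐᵒᵖ R) M)) :
    Subsingleton (((tor R (i + 1)).obj (ModuleCat.of Rᵐᵒᵖ (J → R))).obj M) := by
  have := fun _ : J => subsingleton_tor_succ_self (M := M) i
  exact h.1.subsingleton

end Tor

/-! ### Gaining one degree of presentation. -/

section Coherent

variable {R : Type u} [Ring R] {M : ModuleCat.{u} R}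

theorem IsNPresented.succ_of_subsingleton_tor {n : ℕ} (h : IsNPresented R (n + 1) M)
    (hT : ∀ J : Type u, Subsingleton (((tor R (n + 1)).obj (ModuleCat.of Rᵐᵒᵖ (J → R))).obj M)) :
    IsNPresented R (n + 2) M := by
  obtain ⟨Q, hQ⟩ := h.exists_projectiveResolution
  refine isNPresented_succ_of_resolution Q hQ ?_
  obtain ⟨_, _⟩ := hQ n (by omega)
  obtain ⟨_, _⟩ := hQ (n + 1) le_rfl
  exact ker_fg_of_exact_tensor (Q.complex.d (n + 2) (n + 1)).hom (Q.complex.d (n + 1) n).hom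
    (fun x => (resolution_exact_succ Q n _).2 ⟨x, rfl⟩)
    ((subsingleton_tor_succ_iff Q _ n).1 (hT _))

theorem IsNPresented.succ_of_extColimitComparison_surjective {n : ℕ}
    (h : IsNPresented R (n + 1) M)
    (hE : ∀ (J : Type u) [Preorder J] [IsDirectedOrder J] [Nonempty J] (N : J ⥤ ModuleCat.{u} R),
      Function.Surjective (extColimitComparison (n + 1) N M)) :
    IsNPresented R (n + 2) M := by
  obtain ⟨Q, hQ⟩ := h.exists_projectiveResolution
  refine isNPresented_succ_of_resolution Q hQ ?_
  obtain ⟨_, _⟩ := hQ n (by omega)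
  obtain ⟨_, _⟩ := hQ (n + 1) le_rfl
  exact ker_fg_of_extColimitComparison_surjective Q n (hE _ _)

end Coherent

end RelCoherent

theorem mainTheorem4 (R : Type u) [Ring R] (X : ModuleCat.{u} R → Prop) (n : ℕ) (hn : 1 ≤ n)
    (hX : ∃ M : ModuleCat.{u} R, RelCoherent.presentedSubclass R X n M) :
    List.TFAE [
      RelCoherent.IsLeftCoherent R X n,
      ∀ (J : Type u) (M : ModuleCat.{u} R), RelCoherent.presentedSubclass R X n M →
        Function.Bijective (RelCoherent.powerTensorMap (R := R) J M) ∧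
        ∀ i : ℕ, 0 < i → i ≤ n →
          Subsingleton (((RelCoherent.tor R i).obj (ModuleCat.of Rᵐᵒᵖ (J → R))).obj M),
      ∀ (J : Type u) (P : J → ModuleCat.{u} Rᵐᵒᵖ) (i : ℕ), i ≤ n →
        ∀ M : ModuleCat.{u} R, RelCoherent.presentedSubclass R X n M →
          Function.Bijective (RelCoherent.torPiComparison i P M),
      ∀ (J : Type u) [Preorder J] [IsDirectedOrder J] [Nonempty J]
        (N : J ⥤ ModuleCat.{u} R) (i : ℕ), i ≤ n →
        ∀ M : ModuleCat.{u} R, RelCoherent.presentedSubclass R X n M →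
          Function.Bijective (RelCoherent.extColimitComparison i N M)] := by
  obtain ⟨n, rfl⟩ : ∃ m, n = m + 1 := ⟨n - 1, by omega⟩
  tfae_have 1 → 3 := fun h J P i hi M hM => (h.2 M hM).torPiComparison_bijective hi P
  tfae_have 3 → 2 := by
    intro h J M hM
    -- In degree `0` finite presentation, guaranteed by `1 ≤ n`, already suffices.
    refine ⟨(hM.2.mono hn).powerTensorMap_bijective J, fun i hi0 hi => ?_⟩
    obtain ⟨i, rfl⟩ : ∃ m, i = m + 1 := ⟨i - 1, by omega⟩
    exact RelCoherent.subsingleton_tor_power (h J _ (i + 1) hi M hM)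
  tfae_have 2 → 1 := fun h => ⟨hX, fun M hM =>
    hM.2.succ_of_subsingleton_tor fun J => (h J M hM).2 (n + 1) n.succ_pos le_rfl⟩
  tfae_have 1 → 4 := fun h J _ _ _ N i hi M hM => (h.2 M hM).extColimitComparison_bijective N hi
  tfae_have 4 → 1 := fun h => ⟨hX, fun M hM =>
    hM.2.succ_of_extColimitComparison_surjective fun J _ _ _ N => (h J N (n + 1) le_rfl M hM).2⟩
  tfae_finish
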